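/- For natural numbers $m,n$ let $\mathrm{Grid}_{m\times n}$ be the graph with vertices $v_{i,j}$, $1\le i\le m$, $1\le j\le n$, in which two vertices are adjacent if and only if they are consecutive in the same row or in the same column. A balanced dominating function (BDF) on a graph $G$ is a map $f\colon V(G)\to\{-1,0,1\}$ such that $\sum_{u\in N[v]}f(u)=0$ for every vertex $v$, where $N[v]$ is the closed neighbourhood of $v$. Define the following blocks. * For $n\equiv 2\pmod 3$, $B_{1\times n}$ is the row $(1,-1,0,1,-1,0,\dots,0,1,-1)$, i.e. copies of $(1,-1)$ separated by single zeros. * For $n\equiv 1\pmod 2$, $B_{2\times n}$ is the $2\times n$ matrix with first row $(1,0,-1,0,1,0,-1,\dots)$, i.e. alternating $1,-1,1,\dots$ separated by single zeros, and with second row equal to the negative of the first row. * For $n\equiv 4\pmod 5$ and $t\in\{1,2,3\}$, $B^{(t)}_{4\times n}=P_t\,|\,\mathbf 0\,|\,P_t\,|\,\mathbf 0\,|\cdots|\,\mathbf 0\,|\,P_t$, where $\mathbf 0$ is a $4\times 1$ zero column and $$P_1=\begin{pmatrix}0&1&-1&0\\-1&0&0&1\\1&0&0&-1\\0&-1&1&0\end{pmatrix},\quad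 P_2=\begin{pmatrix}1&-1&1&-1\\0&-1&1&0\\0&1&-1&0\\-1&1&-1&1\end{pmatrix},\quad P_3=\begin{pmatrix}1&0&0&-1\\-1&-1&1&1\\1&1&-1&-1\\-1&0&0&1\end{pmatrix}.$$ **Theorem.** Let $m\le n$ and let $f$ be a non-zero BDF on $\mathrm{Grid}_{m\times n}$. Then the $m\times n$ matrix $(f(v_{i,j}))$ is described by at least one of the following schemes, in each of which any two consecutive blocks are separated by exactly one zero row of length $n$, and both the first and the last rows of the matrix belong to blocks. * Type 1: $m\equiv 1\pmod 2$, $n\equiv 2\pmod 3$, and the blocks from top to bottom are alternately $B_{1\times n},-B_{1\times n},B_{1\times n},\dots$, or alternately $-B_{1\times n},B_{1\times n},-B_{1\times n},\dots$. * Type 2: $m\equiv 2\pmod 3$, $n\equiv 1\pmod 2$, and either all blocks are $B_{2\times n}$ or all blocks are $-B_{2\times n}$. * Type 3: $m\equiv n\equiv 4\pmod 5$, and for some $t\in\{1,2,3\}$ either all blocks are $B^{(t)}_{4\times n}$ or all blocks are $-B^{(t)}_{4\times n}$. -/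

import Mathlib

/-- The grid graph with `m` rows and `n` columns: the vertex in row `i` and column `j` is `(i, j)`
(indices start at `0`), and vertices are adjacent when they are consecutive in a row or a column. -/
def gridGraph (m n : ℕ) : SimpleGraph (Fin m × Fin n) :=
  (SimpleGraph.pathGraph m).boxProd (SimpleGraph.pathGraph n)

open Classical in
/-- A balanced dominating function: a labelling of the vertices by `-1, 0, 1` whose sum over every
closed neighbourhood is zero. -/
def IsBDF {V : Type*} [Fintype V] (G : SimpleGraph V) (f : V → ℤ) : Prop :=
  (∀ v, f v = -1 ∨ f v = 0 ∨ f v = 1) ∧ ∀ v, ∑ u ∈ insert v (G.neighborFinset v), f u = 0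

/-- `P 0 | 0 | P 1 | 0 | P 2 | ...`: the matrices `P q`, of width `w`, are placed side by side with
one zero column between consecutive ones, up to a total width of `n`. -/
def sideBySide {h w : ℕ} (n : ℕ) (P : ℕ → Matrix (Fin h) (Fin w) ℤ) : Matrix (Fin h) (Fin n) ℤ :=
  fun i j => if hj : (j : ℕ) % (w + 1) < w then P (j / (w + 1)) i ⟨j % (w + 1), hj⟩ else 0

/-- The blocks `B q`, of height `h`, are placed one below the other with one zero row between
consecutive ones, up to a total height of `m`. -/
def stacked {h n : ℕ} (m : ℕ) (B : ℕ → Matrix (Fin h) (Fin n) ℤ) : Matrix (Fin m) (Fin n) ℤ :=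
  fun i j => if hi : (i : ℕ) % (h + 1) < h then B (i / (h + 1)) ⟨i % (h + 1), hi⟩ j else 0

/-- `1 -1 | 0 1 -1 | 0 1 -1 | ...` -/
def blockOne (n : ℕ) : Matrix (Fin 1) (Fin n) ℤ :=
  sideBySide n fun _ => !![1, -1]

/-- First row `1 | 0 -1 | 0 1 | 0 -1 | ...`, second row its negative. -/
def blockTwo (n : ℕ) : Matrix (Fin 2) (Fin n) ℤ :=
  sideBySide n fun q => (-1 : ℤ) ^ q • !![1; -1]

/-- The three `4 × 4` patterns. -/
def pattern : Fin 3 → Matrix (Fin 4) (Fin 4) ℤ :=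
  ![!![ 0,  1, -1,  0;
       -1,  0,  0,  1;
        1,  0,  0, -1;
        0, -1,  1,  0],
    !![ 1, -1,  1, -1;
        0, -1,  1,  0;
        0,  1, -1,  0;
       -1,  1, -1,  1],
    !![ 1,  0,  0, -1;
       -1, -1,  1,  1;
        1,  1, -1, -1;
       -1,  0,  0,  1]]

/-- `P | 0 | P | 0 | ... | 0 | P`, where `P` is the pattern with index `t`. -/
def blockFour (t : Fin 3) (n : ℕ) : Matrix (Fin 4) (Fin n) ℤ :=
  sideBySide n fun _ => pattern t

/-- `f` is the labelling of the grid whose labels are the entries of `A`. -/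
def IsLabelledBy {m n : ℕ} (f : Fin m × Fin n → ℤ) (A : Matrix (Fin m) (Fin n) ℤ) : Prop :=
  ∀ i j, f (i, j) = A i j

/-- Type 1: the blocks are `B, -B, B, ...` or `-B, B, -B, ...` with `B` the block of height `1`. -/
def IsTypeOne {m n : ℕ} (f : Fin m × Fin n → ℤ) : Prop :=
  m ≡ 1 [MOD 2] ∧ n ≡ 2 [MOD 3] ∧
    (IsLabelledBy f (stacked m fun q => (-1 : ℤ) ^ q • blockOne n) ∨
      IsLabelledBy f (stacked m fun q => (-1 : ℤ) ^ (q + 1) • blockOne n))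

/-- Type 2: the blocks are all `B` or all `-B` with `B` the block of height `2`. -/
def IsTypeTwo {m n : ℕ} (f : Fin m × Fin n → ℤ) : Prop :=
  m ≡ 2 [MOD 3] ∧ n ≡ 1 [MOD 2] ∧
    (IsLabelledBy f (stacked m fun _ => blockTwo n) ∨
      IsLabelledBy f (stacked m fun _ => -blockTwo n))

/-- Type 3: the blocks are all `B` or all `-B` with `B` one of the three blocks of height `4`. -/
def IsTypeThree {m n : ℕ} (f : Fin m × Fin n → ℤ) : Prop :=
  m ≡ 4 [MOD 5] ∧ n ≡ 4 [MOD 5] ∧ ∃ t : Fin 3,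
    (IsLabelledBy f (stacked m fun _ => blockFour t n) ∨
      IsLabelledBy f (stacked m fun _ => -blockFour t n))

/-! Reflecting `f` oddly across the lines just outside the grid gives a function `F` on ℤ × ℤ that
is odd and periodic in both variables, with values in {-1, 0, 1} and zero sum over every closed
neighbourhood (`IsBDF.exists_extension`). A discrete Fourier transform turns this balance into an
algebraic condition: a frequency can occur only if its characters z, w satisfy 1 + z + z⁻¹ + w + w⁻¹
= 0, and oddness excludes z² = 1 and w² = 1.

By Galois conjugation the roots of unity solving this equation have orders dividing (4, 3), (3, 4)
or (5, 5) (`roots_of_unity_of_relation`). Hence F = A + B + C, with summands odd and periodic with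
these pairs of periods (`IsBalanced.exists_decomposition`).

An odd sequence of period 3 or 4 is determined by its value at 1, so A and B are determined by A 1 1
and B 1 1. As the periods 4, 3, 5 are pairwise coprime, points of the plane can be chosen that
isolate or combine the summands at will; two nonzero summands would produce a value outside {-1, 0,
1} (`IsBalanced.isOddPeriodic`). So a single pair of periods remains: (4, 3) gives Type 1, (3, 4)
gives Type 2, and (5, 5), where balance leaves two free parameters, gives Type 3. -/

/-! ### Roots of unity with 1 + z + z⁻¹ + w + w⁻¹ = 0 -/

/-- Galois conjugation: a primitive root θ and θ ^ k have the same minimal polynomial over ℤ, so an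
integral polynomial relation passes from one to the other. -/
theorem relation_pow_of_coprime {z w : ℂ} {N k : ℕ} (hN : 0 < N) (hz : z ^ N = 1) (hw : w ^ N = 1)
    (hk : k.Coprime N) (h : 1 + z + z⁻¹ + w + w⁻¹ = 0) :
    1 + z ^ k + (z ^ k)⁻¹ + w ^ k + (w ^ k)⁻¹ = 0 := by
  have hθ := Complex.isPrimitiveRoot_exp N hN.ne'
  set θ : ℂ := Complex.exp (2 * Real.pi * Complex.I / N)
  have : NeZero N := ⟨hN.ne'⟩
  obtain ⟨a, ha, rfl⟩ := hθ.eq_pow_of_pow_eq_one hz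
  obtain ⟨b, hb, rfl⟩ := hθ.eq_pow_of_pow_eq_one hw
  have hinv : ∀ {φ : ℂ} {c : ℕ}, φ ^ N = 1 → c < N → φ ^ (N - c) = (φ ^ c)⁻¹ := by
    intro φ c hφ hc
    refine eq_inv_of_mul_eq_one_left ?_
    rw [← pow_add, Nat.sub_add_cancel hc.le, hφ]
  -- The exponents `N - a` and `N - b` stand for inverses, so that the relation becomes a
  -- polynomial.
  let Q : Polynomial ℤ :=
    1 + Polynomial.X ^ a + Polynomial.X ^ (N - a) + Polynomial.X ^ b + Polynomial.X ^ (N - b)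
  have hQ : ∀ φ : ℂ, φ ^ N = 1 →
      Polynomial.aeval φ Q = 1 + φ ^ a + (φ ^ a)⁻¹ + φ ^ b + (φ ^ b)⁻¹ := by
    intro φ hφ
    simp [Q, hinv hφ ha, hinv hφ hb]
  have hdvd : minpoly ℤ θ ∣ Q := by
    refine minpoly.isIntegrallyClosed_dvd (hθ.isIntegral hN) ?_
    rw [hQ θ hθ.pow_eq_one, h]
  rw [hθ.minpoly_eq_pow_coprime hk] at hdvd
  have hroot : Polynomial.aeval (θ ^ k) Q = 0 :=
    Polynomial.aeval_eq_zero_of_dvd_aeval_eq_zero hdvd (minpoly.aeval ℤ (θ ^ k))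
  rw [hQ _ (by rw [← pow_mul, mul_comm, pow_mul, hθ.pow_eq_one, one_pow])] at hroot
  rwa [pow_right_comm θ a k, pow_right_comm θ b k]

theorem sum_pow_progression_eq_zero {z : ℂ} {q M : ℕ} (hz : z ^ (q * M) = 1) (h1 : z ^ M ≠ 1) :
    ∑ s ∈ Finset.range q, z ^ (1 + s * M) = 0 := by
  have h : ∀ s, z ^ (1 + s * M) = z * (z ^ M) ^ s := by
    intro s
    rw [pow_add, pow_one, mul_comm s, pow_mul]
  simp only [h]
  rw [← Finset.mul_sum, geom_sum_eq h1, ← pow_mul, mul_comm M, hz]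
  simp

theorem sum_pow_progression_eq {z : ℂ} {M : ℕ} (q : ℕ) (h1 : z ^ M = 1) :
    ∑ s ∈ Finset.range q, z ^ (1 + s * M) = q * z := by
  have h : ∀ s, z ^ (1 + s * M) = z := by
    intro s
    rw [pow_add, pow_one, mul_comm s, pow_mul, h1, one_pow, mul_one]
  simp [h]

theorem sum_relation_progression (z w : ℂ) (q M : ℕ) :
    ∑ s ∈ Finset.range q, (1 + z ^ (1 + s * M) + (z ^ (1 + s * M))⁻¹ + w ^ (1 + s * M) +
      (w ^ (1 + s * M))⁻¹) =
    q + ∑ s ∈ Finset.range q, z ^ (1 + s * M) + ∑ s ∈ Finset.range q, z⁻¹ ^ (1 + s * M) +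
      ∑ s ∈ Finset.range q, w ^ (1 + s * M) + ∑ s ∈ Finset.range q, w⁻¹ ^ (1 + s * M) := by
  simp only [Finset.sum_add_distrib, inv_pow]
  simp

theorem pow_four_pow_three_of_add_inv {z w : ℂ} (hz0 : z ≠ 0) (hw0 : w ≠ 0)
    (h : 1 + z + z⁻¹ + w + w⁻¹ = 0) (hw : 1 + w + w⁻¹ = 0) : z ^ 4 = 1 ∧ w ^ 3 = 1 := by
  have h1 : z + z⁻¹ = 0 := by linear_combination h - hw
  field_simp at h1 hw
  constructor
  · linear_combination (z ^ 2 - 1) * h1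
  · linear_combination (w - 1) * hw

/-- As q ∣ M, every exponent 1 + sM is coprime to qM, so the relation holds for all q conjugates.
Adding them cancels each variable whose M-th power is not 1 and multiplies everything else by q. The
constant cannot survive alone, so exactly one variable does, and the relation splits in two. -/
theorem relation_of_sq_dvd {z w : ℂ} {q M : ℕ} (hq : q.Prime) (hM : 0 < M) (hqM : q ∣ M)
    (hz : z ^ (q * M) = 1) (hw : w ^ (q * M) = 1) (hne : z ^ M ≠ 1 ∨ w ^ M ≠ 1)
    (h : 1 + z + z⁻¹ + w + w⁻¹ = 0) :
    (z ^ 4 = 1 ∧ w ^ 3 = 1) ∨ (z ^ 3 = 1 ∧ w ^ 4 = 1) := by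
  have hN : 0 < q * M := Nat.mul_pos hq.pos hM
  have hz0 : z ≠ 0 := by rintro rfl; simp [hN.ne'] at hz
  have hw0 : w ≠ 0 := by rintro rfl; simp [hN.ne'] at hw
  have hq0 : (q : ℂ) ≠ 0 := by exact_mod_cast hq.ne_zero
  have hzi : z⁻¹ ^ (q * M) = 1 := by rw [inv_pow, hz, inv_one]
  have hwi : w⁻¹ ^ (q * M) = 1 := by rw [inv_pow, hw, inv_one]
  have hinv : ∀ {x : ℂ}, x⁻¹ ^ M = 1 ↔ x ^ M = 1 := by
    intro x
    rw [inv_pow, inv_eq_one]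
  have hsum := sum_relation_progression z w q M
  rw [Finset.sum_eq_zero] at hsum
  swap
  · intro s _
    refine relation_pow_of_coprime hN hz hw ?_ h
    have : (1 + s * M).Coprime M := by simp
    exact Nat.Coprime.mul_right (this.coprime_dvd_right hqM) this
  by_cases hzM : z ^ M = 1
  · have hwM : w ^ M ≠ 1 := by tauto
    rw [sum_pow_progression_eq q hzM, sum_pow_progression_eq q (hinv.2 hzM),
      sum_pow_progression_eq_zero hw hwM, sum_pow_progression_eq_zero hwi (mt hinv.1 hwM)] at hsum
    have h1 : 1 + z + z⁻¹ = 0 := by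
      apply mul_left_cancel₀ hq0
      linear_combination -hsum
    exact Or.inr (pow_four_pow_three_of_add_inv hw0 hz0 (by linear_combination h) h1).symm
  · by_cases hwM : w ^ M = 1
    · rw [sum_pow_progression_eq q hwM, sum_pow_progression_eq q (hinv.2 hwM),
        sum_pow_progression_eq_zero hz hzM, sum_pow_progression_eq_zero hzi (mt hinv.1 hzM)] at hsum
      have h1 : 1 + w + w⁻¹ = 0 := by
        apply mul_left_cancel₀ hq0
        linear_combination -hsum
      exact Or.inl (pow_four_pow_three_of_add_inv hz0 hw0 h h1)
    · rw [sum_pow_progression_eq_zero hw hwM, sum_pow_progression_eq_zero hwi (mt hinv.1 hwM),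
        sum_pow_progression_eq_zero hz hzM, sum_pow_progression_eq_zero hzi (mt hinv.1 hzM)] at hsum
      simp only [add_zero] at hsum
      exact absurd hsum.symm hq0

/-- The order of `z` is divisible by `q`, the order of `w` is not. -/
theorem relation_false_of_unramified {z w : ℂ} {q M : ℕ} (hq : q.Prime) (hq5 : 5 ≤ q) (hM : 0 < M)
    (hqM : q.Coprime M) (hz : z ^ (q * M) = 1) (hzM : z ^ M ≠ 1) (hwM : w ^ M = 1)
    (h : 1 + z + z⁻¹ + w + w⁻¹ = 0) : False := by
  have hN : 0 < q * M := Nat.mul_pos hq.pos hM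
  have hz0 : z ≠ 0 := by rintro rfl; simp [hN.ne'] at hz
  have hw : w ^ (q * M) = 1 := by rw [mul_comm, pow_mul, hwM, one_pow]
  -- Conjugation by this exponent fixes `w` and acts as squaring on the q-part of `z`.
  obtain ⟨k, hk2, hk1⟩ := Nat.chineseRemainder hqM 2 1
  have hcop : k.Coprime (q * M) := by
    refine Nat.Coprime.mul_right ?_ ?_
    · rw [Nat.Coprime, hk2.gcd_eq]
      exact (Nat.coprime_primes Nat.prime_two hq).2 (by omega)
    · rw [Nat.Coprime, hk1.gcd_eq]
      simp
  have hV := relation_pow_of_coprime hN hz hw hcop h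
  have hk0 : 1 ≤ k := by
    by_contra hlt
    have : k = 0 := by omega
    subst this
    have := (Nat.modEq_zero_iff_dvd.1 hk2.symm)
    exact absurd (Nat.le_of_dvd (by norm_num) this) (by omega)
  have hwk : w ^ k = w := by
    obtain ⟨c, hc⟩ := (Nat.modEq_iff_dvd' hk0).1 hk1.symm
    rw [show k = M * c + 1 by omega, pow_succ, pow_mul, hwM, one_pow, one_mul]
  rw [hwk] at hV
  have hzk0 : z ^ k ≠ 0 := pow_ne_zero _ hz0
  have hprod : (z ^ k - z) * (z ^ k * z - 1) = 0 := by
    have h1 : z ^ k + (z ^ k)⁻¹ = z + z⁻¹ := by linear_combination hV - h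
    field_simp at h1
    linear_combination h1
  have hord : q ∣ orderOf z := by
    by_contra hnd
    have h2 : (orderOf z).Coprime q := ((Nat.Prime.coprime_iff_not_dvd hq).2 hnd).symm
    exact hzM (orderOf_dvd_iff_pow_eq_one.1 (h2.dvd_of_dvd_mul_left (orderOf_dvd_of_pow_eq_one hz)))
  have hk2' : (k : ℤ) ≡ 2 [ZMOD q] := by exact_mod_cast (Int.natCast_modEq_iff.2 hk2)
  -- Either z ^ k = z or z ^ k = z⁻¹, so q divides k - 1 or k + 1, that is, 1 or 3; both are
  -- impossible for q ≥ 5.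
  rcases mul_eq_zero.1 hprod with h0 | h0
  · have h1 : z ^ (k - 1) = 1 := by
      apply mul_right_cancel₀ hz0
      rw [← pow_succ, Nat.sub_add_cancel hk0, one_mul]
      linear_combination h0
    have h2 := hord.trans (orderOf_dvd_of_pow_eq_one h1)
    have h3 : 1 ≡ k [MOD q] := (Nat.modEq_iff_dvd' hk0).2 h2
    have h4 := (Nat.modEq_iff_dvd' (by norm_num)).1 (h3.trans hk2)
    exact absurd (Nat.le_of_dvd (by norm_num) h4) (by omega)
  · have h1 : z ^ (k + 1) = 1 := by
      rw [pow_succ]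
      linear_combination h0
    have h2 := hord.trans (orderOf_dvd_of_pow_eq_one h1)
    have h3 : 2 + 1 ≡ 0 [MOD q] :=
      ((hk2.add_right 1).symm).trans (Nat.modEq_zero_iff_dvd.2 h2)
    exact absurd (Nat.le_of_dvd (by norm_num) (Nat.modEq_zero_iff_dvd.1 h3)) (by omega)

theorem add_inv_eq_two_mul_re {z : ℂ} (hz : ‖z‖ = 1) : z + z⁻¹ = ((2 * z.re : ℝ) : ℂ) := by
  rw [Complex.inv_eq_conj hz, Complex.add_conj]

theorem eq_one_of_norm_of_re {z : ℂ} (hz : ‖z‖ = 1) (h : z.re = 1) : z = 1 := by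
  have h1 := Complex.sq_norm z
  rw [hz, Complex.normSq_apply, h] at h1
  have him : z.im = 0 := by
    have : z.im * z.im = 0 := by linarith
    simpa using this
  exact Complex.ext (by simpa using h) (by simpa using him)

theorem pow_five_of_pow_eq_one {z : ℂ} {M k : ℕ} (hz : z ^ (5 * M) = 1) (hk : z ^ k = 1)
    (hkM : k.Coprime M) : z ^ 5 = 1 := by
  have h1 : orderOf z ∣ 5 * M := orderOf_dvd_of_pow_eq_one hz
  have h2 : orderOf z ∣ k := orderOf_dvd_of_pow_eq_one hk
  exact orderOf_dvd_iff_pow_eq_one.1 ((hkM.coprime_dvd_left h2).dvd_of_dvd_mul_right h1)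

/-- Summed over the exponents 1 + sM, the four variable terms cancel and the total is q. All but one
of these exponents are coprime to qM and contribute 0, so the exceptional one contributes q. A sum
of five numbers of modulus 1 equals q ≥ 5 only if q = 5 and all of them are 1. -/
theorem relation_of_ramified {z w : ℂ} {q M : ℕ} (hq : q.Prime) (hq5 : 5 ≤ q) (hM : 0 < M)
    (hqM : q.Coprime M) (hz : z ^ (q * M) = 1) (hw : w ^ (q * M) = 1) (hzM : z ^ M ≠ 1)
    (hwM : w ^ M ≠ 1) (h : 1 + z + z⁻¹ + w + w⁻¹ = 0) : z ^ 5 = 1 ∧ w ^ 5 = 1 := by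
  have hN : 0 < q * M := Nat.mul_pos hq.pos hM
  have hzi : z⁻¹ ^ (q * M) = 1 := by rw [inv_pow, hz, inv_one]
  have hwi : w⁻¹ ^ (q * M) = 1 := by rw [inv_pow, hw, inv_one]
  have hinv : ∀ {x : ℂ}, x⁻¹ ^ M = 1 → x ^ M = 1 := by
    intro x hx
    rwa [inv_pow, inv_eq_one] at hx
  have hcopM : ∀ s, (1 + s * M).Coprime M := fun s => by simp
  have hsum := sum_relation_progression z w q M
  rw [sum_pow_progression_eq_zero hw hwM, sum_pow_progression_eq_zero hwi (mt hinv hwM),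
    sum_pow_progression_eq_zero hz hzM, sum_pow_progression_eq_zero hzi (mt hinv hzM)] at hsum
  obtain ⟨s₀, hs₀, hdvd⟩ : ∃ s₀ < q, q ∣ 1 + s₀ * M := by
    have := Fact.mk hq
    have hM0 : (M : ZMod q) ≠ 0 := by
      rw [Ne, ZMod.natCast_eq_zero_iff]
      exact (Nat.Prime.coprime_iff_not_dvd hq).1 hqM
    refine ⟨(-(M : ZMod q)⁻¹).val, ZMod.val_lt _, ?_⟩
    rw [← ZMod.natCast_eq_zero_iff]
    push_cast
    rw [ZMod.natCast_zmod_val, neg_mul, inv_mul_cancel₀ hM0]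
    ring
  rw [Finset.sum_eq_single_of_mem s₀ (Finset.mem_range.2 hs₀)] at hsum
  swap
  · intro s hs hne
    refine relation_pow_of_coprime hN hz hw (Nat.Coprime.mul_right ?_ (hcopM s)) h
    refine ((Nat.Prime.coprime_iff_not_dvd hq).2 fun hds => hne ?_).symm
    have h1 : s * M ≡ s₀ * M [MOD q] := by
      refine Nat.ModEq.add_left_cancel' 1 ?_
      exact (Nat.modEq_zero_iff_dvd.2 hds).trans (Nat.modEq_zero_iff_dvd.2 hdvd).symm
    exact (Nat.ModEq.cancel_right_of_coprime hqM h1).eq_of_lt_of_lt (Finset.mem_range.1 hs) hs₀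
  have hnorm : ∀ {x : ℂ}, x ^ (q * M) = 1 → ‖x ^ (1 + s₀ * M)‖ = 1 := by
    intro x hx
    rw [norm_pow, Complex.norm_eq_one_of_pow_eq_one hx hN.ne', one_pow]
  have hz1 := hnorm hz
  have hw1 := hnorm hw
  have hre : 1 + 2 * (z ^ (1 + s₀ * M)).re + 2 * (w ^ (1 + s₀ * M)).re = (q : ℝ) := by
    have e1 := add_inv_eq_two_mul_re hz1
    have e2 := add_inv_eq_two_mul_re hw1
    have : ((1 + 2 * (z ^ (1 + s₀ * M)).re + 2 * (w ^ (1 + s₀ * M)).re : ℝ) : ℂ) = (q : ℝ) := by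
      push_cast at e1 e2 ⊢
      linear_combination hsum - e1 - e2
    exact_mod_cast this
  have hzle : (z ^ (1 + s₀ * M)).re ≤ 1 := hz1 ▸ Complex.re_le_norm _
  have hwle : (w ^ (1 + s₀ * M)).re ≤ 1 := hw1 ▸ Complex.re_le_norm _
  have hq5' : (5 : ℝ) ≤ q := by exact_mod_cast hq5
  have hq_eq : q = 5 := by
    have : (q : ℝ) = 5 := by linarith
    exact_mod_cast this
  subst hq_eq
  exact ⟨pow_five_of_pow_eq_one hz (eq_one_of_norm_of_re hz1 (by linarith)) (hcopM _),
    pow_five_of_pow_eq_one hw (eq_one_of_norm_of_re hw1 (by linarith)) (hcopM _)⟩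

/-- Each of z + z⁻¹ and w + w⁻¹ is 1 or -1, and 1 ± 1 ± 1 is odd. -/
theorem relation_false_of_pow_six {z w : ℂ} (hz : z ^ 6 = 1) (hw : w ^ 6 = 1) (hz2 : z ^ 2 ≠ 1)
    (hw2 : w ^ 2 ≠ 1) (h : 1 + z + z⁻¹ + w + w⁻¹ = 0) : False := by
  have key : ∀ {x : ℂ}, x ^ 6 = 1 → x ^ 2 ≠ 1 → x + x⁻¹ = 1 ∨ x + x⁻¹ = -1 := by
    intro x hx hx2
    have hx0 : x ≠ 0 := by rintro rfl; norm_num at hx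
    have h1 : (x ^ 2 - x + 1) * (x ^ 2 + x + 1) = 0 := by
      apply mul_left_cancel₀ (sub_ne_zero.2 hx2)
      linear_combination hx
    rcases mul_eq_zero.1 h1 with h1 | h1
    · left
      field_simp
      linear_combination h1
    · right
      field_simp
      linear_combination h1
  rcases key hz hz2 with h1 | h1 <;> rcases key hw hw2 with h2 | h2
  · have : (3 : ℂ) = 0 := by linear_combination h - h1 - h2
    norm_num at this
  · have : (1 : ℂ) = 0 := by linear_combination h - h1 - h2
    norm_num at this
  · have : (1 : ℂ) = 0 := by linear_combination h - h1 - h2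
    norm_num at this
  · have : (-1 : ℂ) = 0 := by linear_combination h - h1 - h2
    norm_num at this

theorem roots_of_unity_of_relation {z w : ℂ} {L : ℕ} (hL : 0 < L) (hz : z ^ L = 1) (hw : w ^ L = 1)
    (hz2 : z ^ 2 ≠ 1) (hw2 : w ^ 2 ≠ 1) (h : 1 + z + z⁻¹ + w + w⁻¹ = 0) :
    (z ^ 4 = 1 ∧ w ^ 3 = 1) ∨ (z ^ 3 = 1 ∧ w ^ 4 = 1) ∨ (z ^ 5 = 1 ∧ w ^ 5 = 1) := by
  set N := Nat.lcm (orderOf z) (orderOf w) with hNdef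
  have hN : 0 < N := Nat.pos_of_dvd_of_pos
    (Nat.lcm_dvd (orderOf_dvd_of_pow_eq_one hz) (orderOf_dvd_of_pow_eq_one hw)) hL
  have hzN : z ^ N = 1 := orderOf_dvd_iff_pow_eq_one.1 (Nat.dvd_lcm_left _ _)
  have hwN : w ^ N = 1 := orderOf_dvd_iff_pow_eq_one.1 (Nat.dvd_lcm_right _ _)
  -- `N` is the least common exponent of `z` and `w`, so no proper divisor annihilates both.
  have hne : ∀ {q M : ℕ}, q.Prime → N = q * M → 0 < M ∧ (z ^ M ≠ 1 ∨ w ^ M ≠ 1) := by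
    intro q M hq hNM
    have hM : 0 < M := Nat.pos_of_ne_zero (by rintro rfl; omega)
    refine ⟨hM, ?_⟩
    by_contra! hcon
    have h1 : N ∣ M :=
      Nat.lcm_dvd (orderOf_dvd_of_pow_eq_one hcon.1) (orderOf_dvd_of_pow_eq_one hcon.2)
    have h2 := Nat.le_of_dvd hM h1
    have h3 := hq.two_le
    nlinarith
  by_cases hsq : Squarefree N
  · by_cases hbig : ∃ q, q.Prime ∧ 5 ≤ q ∧ q ∣ N
    · obtain ⟨q, hq, hq5, M, hNM⟩ := hbig
      obtain ⟨hM, hne⟩ := hne hq hNM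
      have hqM : q.Coprime M := by
        rw [hNM] at hsq
        exact Nat.coprime_of_squarefree_mul hsq
      rw [hNM] at hzN hwN
      by_cases hzM : z ^ M = 1
      · exact (relation_false_of_unramified hq hq5 hM hqM hwN (by tauto) hzM
          (by linear_combination h)).elim
      · by_cases hwM : w ^ M = 1
        · exact (relation_false_of_unramified hq hq5 hM hqM hzN hzM hwM h).elim
        · exact Or.inr (Or.inr (relation_of_ramified hq hq5 hM hqM hzN hwN hzM hwM h))
    · have h6 : N ∣ 6 := by
        rw [← Nat.prod_primeFactors_of_squarefree hsq]
        have hsub : N.primeFactors ⊆ {2, 3} := by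
          intro p hp
          have hp' := Nat.prime_of_mem_primeFactors hp
          have hlt : p < 5 := by
            by_contra hge
            exact hbig ⟨p, hp', by omega, Nat.dvd_of_mem_primeFactors hp⟩
          have := hp'.two_le
          have h4 : p ≠ 4 := by rintro rfl; norm_num at hp'
          simp only [Finset.mem_insert, Finset.mem_singleton]
          omega
        simpa using Finset.prod_dvd_prod_of_subset _ _ (fun p => p) hsub
      obtain ⟨c, hc⟩ := h6
      refine (relation_false_of_pow_six ?_ ?_ hz2 hw2 h).elim
      · rw [hc, pow_mul, hzN, one_pow]
      · rw [hc, pow_mul, hwN, one_pow]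
  · rw [Nat.squarefree_iff_prime_squarefree] at hsq
    push Not at hsq
    obtain ⟨q, hq, M', hM'⟩ := hsq
    have hNM : N = q * (q * M') := by rw [hM', mul_assoc]
    obtain ⟨hM, hne⟩ := hne hq hNM
    rw [hNM] at hzN hwN
    rcases relation_of_sq_dvd hq hM (Dvd.intro _ rfl) hzN hwN hne h with h1 | h1
    · exact Or.inl h1
    · exact Or.inr (Or.inl h1)

/-! ### Odd periodic extension to ℤ × ℤ -/

/-- `F` is odd in each variable, `p`-periodic in the first one and `q`-periodic in the second one. -/
structure IsOddPeriodic {E : Type*} [AddGroup E] (p q : ℤ) (F : ℤ → ℤ → E) : Prop where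
  odd_left : ∀ i j, F (-i) j = -F i j
  odd_right : ∀ i j, F i (-j) = -F i j
  periodic_left : ∀ i j, F (i + p) j = F i j
  periodic_right : ∀ i j, F i (j + q) = F i j

/-- The sum of `F` over every closed neighbourhood of the grid `ℤ × ℤ` is zero. -/
def IsBalanced {E : Type*} [AddGroup E] (F : ℤ → ℤ → E) : Prop :=
  ∀ i j, F i j + F (i + 1) j + F (i - 1) j + F i (j + 1) + F i (j - 1) = 0

theorem apply_emod_of_periodic {E : Type*} {g : ℤ → E} {p : ℤ} (hg : ∀ i, g (i + p) = g i) (i : ℤ) :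
    g (i % p) = g i := by
  have h : Function.Periodic g p := hg
  conv_rhs => rw [← Int.emod_add_mul_ediv i p, mul_comm]
  exact (h.int_mul (i / p) (i % p)).symm

theorem apply_add_mul_of_periodic {E : Type*} {g : ℤ → E} {p : ℤ} (hg : ∀ i, g (i + p) = g i)
    (i k : ℤ) : g (i + k * p) = g i := by
  have h : Function.Periodic g p := hg
  exact h.int_mul k i

/-- Oddness at 0 and the period 2(m + 1) give oddness about m + 1 as well. So `g` vanishes at both
centres, and its values at 1, ..., m determine it. -/
theorem eq_zero_of_odd_of_periodic {m : ℕ} {g : ℤ → ℤ} (hodd : ∀ i, g (-i) = -g i)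
    (hper : ∀ i, g (i + 2 * (m + 1)) = g i) (h : ∀ i : ℕ, i < m → g (i + 1) = 0) (i : ℤ) :
    g i = 0 := by
  have hmid : ∀ i : ℤ, g (2 * (m + 1) - i) = -g i := by
    intro i
    rw [← hodd, ← hper (-i)]
    congr 1
    ring
  have hpos : ∀ i : ℤ, 0 ≤ i → i ≤ m + 1 → g i = 0 := by
    intro i h0 h1
    rcases eq_or_lt_of_le h0 with rfl | h0
    · have := hodd 0
      simp only [neg_zero] at this
      omega
    · rcases eq_or_lt_of_le h1 with rfl | h1
      · have := hmid (m + 1)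
        rw [show (2 * (m + 1) - (m + 1) : ℤ) = m + 1 by ring] at this
        omega
      · have := h (i - 1).toNat (by omega)
        rwa [show (((i - 1).toNat : ℤ) + 1) = i by omega] at this
  rw [← apply_emod_of_periodic hper]
  have h0 := Int.emod_nonneg i (show (2 * (m + 1) : ℤ) ≠ 0 by omega)
  have h1 := Int.emod_lt_of_pos i (show (0 : ℤ) < 2 * (m + 1) by omega)
  set r := i % (2 * (m + 1))
  by_cases hr : r ≤ m + 1
  · exact hpos r h0 hr
  · have := hmid r
    rw [hpos _ (by omega) (by omega)] at this
    omega

/-- The codomain is a general group so that, after each row is extended, the sequence of rows can be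
extended as a sequence of functions. -/
theorem exists_odd_periodic_extension {E : Type*} [AddGroup E] {m : ℕ} (g : Fin m → E) :
    ∃ G : ℤ → E, (∀ i, G (-i) = -G i) ∧ (∀ i, G (i + 2 * (m + 1)) = G i) ∧
      ∀ i : Fin m, G ((i : ℕ) + 1) = g i := by
  let g' : ℤ → E := fun i => if h : 0 < i ∧ i < m + 1 then g ⟨(i - 1).toNat, by omega⟩ else 0
  have hg'0 : ∀ i : ℤ, ¬(0 < i ∧ i < m + 1) → g' i = 0 := fun i hi => dif_neg hi
  let c : ℤ := 2 * (m + 1)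
  refine ⟨fun i => g' (i % c) - g' (c - i % c), fun i => ?_, fun i => ?_, fun i => ?_⟩
  · dsimp only
    rw [neg_sub]
    have h0 := Int.emod_nonneg i (show c ≠ 0 by omega)
    have h1 := Int.emod_lt_of_pos i (show 0 < c by omega)
    by_cases hr : i % c = 0
    · have : -i % c = 0 := by rw [← Int.dvd_iff_emod_eq_zero] at *; exact (Int.dvd_neg).2 hr
      rw [hr, this, hg'0 0 (by omega), hg'0 _ (by omega)]
    · have : -i % c = c - i % c := by
        rw [Int.neg_emod, if_neg (by rwa [Int.dvd_iff_emod_eq_zero])]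
        congr 1
      rw [this]
      congr 2
      ring
  · dsimp only
    rw [show i + 2 * (m + 1) = i + c from rfl, Int.add_emod_right]
  · have hi := i.2
    dsimp only
    rw [Int.emod_eq_of_lt (by omega) (by omega), hg'0 (c - _) (by omega), sub_zero]
    simp only [g']
    rw [dif_pos (by omega)]
    congr 1
    ext
    simp

open Classical in
theorem sum_neighborFinset_pathGraph {m : ℕ} {g : ℤ → ℤ} (h0 : g 0 = 0) (hm : g (m + 1) = 0)
    (i : Fin m) : ∑ a ∈ (SimpleGraph.pathGraph m).neighborFinset i, g ((a : ℕ) + 1) =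
      g ((i : ℕ) + 1 + 1) + g ((i : ℕ) + 1 - 1) := by
  have hset : (SimpleGraph.pathGraph m).neighborFinset i =
      Finset.univ.filter (fun a : Fin m => (i : ℕ) + 1 = a) ∪
        Finset.univ.filter (fun a : Fin m => (a : ℕ) + 1 = i) := by
    ext a
    simp [SimpleGraph.pathGraph_adj]
  have hi := i.2
  rw [hset, Finset.sum_union]
  · congr 1
    · by_cases h : (i : ℕ) + 1 < m
      · rw [Finset.sum_eq_single (⟨i + 1, h⟩ : Fin m)]
        · simp
        · intro b hb hne
          simp only [Finset.mem_filter] at hb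
          exact absurd (Fin.ext hb.2.symm) hne
        · simp
      · rw [Finset.sum_eq_zero, show ((i : ℕ) : ℤ) + 1 + 1 = m + 1 by omega, hm]
        intro a ha
        simp only [Finset.mem_filter] at ha
        omega
    · by_cases h : 0 < (i : ℕ)
      · rw [Finset.sum_eq_single (⟨i - 1, by omega⟩ : Fin m)]
        · congr 1
          dsimp only
          omega
        · intro b hb hne
          simp only [Finset.mem_filter] at hb
          exact absurd (Fin.ext (by dsimp only; omega)) hne
        · intro hb
          simp only [Finset.mem_filter, Finset.mem_univ, true_and] at hb
          omega
      · rw [Finset.sum_eq_zero, show ((i : ℕ) : ℤ) + 1 - 1 = 0 by omega, h0]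
        intro a ha
        simp only [Finset.mem_filter] at ha
        omega
  · rw [Finset.disjoint_left]
    intro a ha hb
    simp only [Finset.mem_filter] at ha hb
    omega

open Classical in
theorem IsBDF.add_sum_neighborFinset {V : Type*} [Fintype V] {G : SimpleGraph V} {f : V → ℤ}
    (hf : IsBDF G f) (v : V) : f v + ∑ u ∈ G.neighborFinset v, f u = 0 := by
  have h := hf.2 v
  rwa [Finset.sum_insert (by simp)] at h

theorem IsBDF.gridGraph_apply {m n : ℕ} {f : Fin m × Fin n → ℤ} (hf : IsBDF (gridGraph m n) f)
    {F : ℤ → ℤ → ℤ} (hF : ∀ (i : Fin m) (j : Fin n), F ((i : ℕ) + 1) ((j : ℕ) + 1) = f (i, j))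
    (h1 : ∀ j, F 0 j = 0) (h2 : ∀ j, F (m + 1) j = 0) (h3 : ∀ i, F i 0 = 0)
    (h4 : ∀ i, F i (n + 1) = 0) (i : Fin m) (j : Fin n) :
    F ((i : ℕ) + 1) ((j : ℕ) + 1) + F ((i : ℕ) + 1 + 1) ((j : ℕ) + 1) +
      F ((i : ℕ) + 1 - 1) ((j : ℕ) + 1) + F ((i : ℕ) + 1) ((j : ℕ) + 1 + 1) +
      F ((i : ℕ) + 1) ((j : ℕ) + 1 - 1) = 0 := by
  classical
  have h := hf.add_sum_neighborFinset (i, j)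
  have hset : (gridGraph m n).neighborFinset (i, j) =
      (((SimpleGraph.pathGraph m).neighborFinset i) ×ˢ {j}) ∪
        ({i} ×ˢ (SimpleGraph.pathGraph n).neighborFinset j) := by
    ext ⟨a, b⟩
    rw [SimpleGraph.mem_neighborFinset, gridGraph, SimpleGraph.boxProd_adj]
    simp only [SimpleGraph.mem_neighborFinset, Finset.mem_union, Finset.mem_product,
      Finset.mem_singleton]
    constructor
    · rintro (⟨h, h'⟩ | ⟨h, h'⟩)
      · exact Or.inl ⟨h, h'.symm⟩
      · exact Or.inr ⟨h'.symm, h⟩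
    · rintro (⟨h, h'⟩ | ⟨h, h'⟩)
      · exact Or.inl ⟨h, h'.symm⟩
      · exact Or.inr ⟨h', h.symm⟩
  have hdisj : Disjoint (((SimpleGraph.pathGraph m).neighborFinset i) ×ˢ {j})
      ({i} ×ˢ (SimpleGraph.pathGraph n).neighborFinset j) := by
    rw [Finset.disjoint_left]
    rintro ⟨a, b⟩ hab hab'
    simp only [Finset.mem_product, SimpleGraph.mem_neighborFinset, Finset.mem_singleton] at hab hab'
    exact hab.1.ne hab'.1.symm
  have hs : ∑ u ∈ (gridGraph m n).neighborFinset (i, j), f u =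
      ∑ a ∈ (SimpleGraph.pathGraph m).neighborFinset i, F ((a : ℕ) + 1) ((j : ℕ) + 1) +
        ∑ b ∈ (SimpleGraph.pathGraph n).neighborFinset j, F ((i : ℕ) + 1) ((b : ℕ) + 1) := by
    rw [hset, Finset.sum_union hdisj, Finset.sum_product, Finset.sum_product]
    simp [hF]
  rw [sum_neighborFinset_pathGraph (g := fun x => F x ((j : ℕ) + 1)) (h1 _) (h2 _),
    sum_neighborFinset_pathGraph (g := fun x => F ((i : ℕ) + 1) x) (h3 _) (h4 _)] at hs
  have hh := hF i j
  have : ∑ u ∈ (gridGraph m n).neighborFinset (i, j), f u = -f (i, j) := by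
    convert (eq_neg_of_add_eq_zero_right h) using 2
  linarith

theorem IsOddPeriodic.apply_zero_left {E : Type*} [AddGroup E] [IsAddTorsionFree E] {p q : ℤ}
    {F : ℤ → ℤ → E} (hF : IsOddPeriodic p q F) (j : ℤ) : F 0 j = 0 := by
  have := hF.odd_left 0 j
  rw [neg_zero] at this
  exact self_eq_neg.1 this

theorem IsOddPeriodic.apply_zero_right {E : Type*} [AddGroup E] [IsAddTorsionFree E] {p q : ℤ}
    {F : ℤ → ℤ → E} (hF : IsOddPeriodic p q F) (i : ℤ) : F i 0 = 0 := by
  have := hF.odd_right i 0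
  rw [neg_zero] at this
  exact self_eq_neg.1 this

theorem IsOddPeriodic.apply_half_left {p q : ℤ} {F : ℤ → ℤ → ℤ} (hF : IsOddPeriodic (2 * p) q F)
    (j : ℤ) : F p j = 0 := by
  have h1 := hF.odd_left p j
  have h2 := hF.periodic_left (-p) j
  rw [show -p + 2 * p = p by ring] at h2
  omega

theorem IsOddPeriodic.apply_half_right {p q : ℤ} {F : ℤ → ℤ → ℤ} (hF : IsOddPeriodic p (2 * q) F)
    (i : ℤ) : F i q = 0 := by
  have h1 := hF.odd_right i q
  have h2 := hF.periodic_right i (-q)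
  rw [show -q + 2 * q = q by ring] at h2
  omega

theorem IsOddPeriodic.eq_zero {m n : ℕ} {F : ℤ → ℤ → ℤ}
    (hF : IsOddPeriodic (2 * (m + 1)) (2 * (n + 1)) F)
    (h : ∀ i j : ℕ, i < m → j < n → F (i + 1) (j + 1) = 0) (i j : ℤ) : F i j = 0 :=
  eq_zero_of_odd_of_periodic (g := fun i => F i j) (fun i => hF.odd_left i j)
    (fun i => hF.periodic_left i j) (fun a ha =>
      eq_zero_of_odd_of_periodic (g := fun j => F (a + 1) j) (hF.odd_right _)
        (hF.periodic_right _) (fun b hb => h a b ha hb) j) i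

theorem exists_isOddPeriodic_extension {m n : ℕ} (f : Fin m × Fin n → ℤ) :
    ∃ F : ℤ → ℤ → ℤ, IsOddPeriodic (2 * (m + 1)) (2 * (n + 1)) F ∧
      ∀ (i : Fin m) (j : Fin n), F ((i : ℕ) + 1) ((j : ℕ) + 1) = f (i, j) := by
  choose G hG1 hG2 hG3 using fun i : Fin m => exists_odd_periodic_extension fun j => f (i, j)
  obtain ⟨F, hF1, hF2, hF3⟩ := exists_odd_periodic_extension G
  refine ⟨F, ⟨fun i j => by rw [hF1, Pi.neg_apply], fun i j => ?_, fun i j => by rw [hF2],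
    fun i j => ?_⟩, fun i j => by rw [hF3, hG3]⟩
  · suffices F i (-j) + F i j = 0 by omega
    refine eq_zero_of_odd_of_periodic (m := m) (g := fun i => F i (-j) + F i j) ?_ ?_ ?_ i
    · intro i
      simp only [hF1, Pi.neg_apply]
      ring
    · intro i
      simp only [hF2]
    · intro a ha
      have := hF3 ⟨a, ha⟩
      simp only at this
      simp only [this, hG1]
      ring
  · suffices F i (j + 2 * (n + 1)) - F i j = 0 by omega
    refine eq_zero_of_odd_of_periodic (m := m)
      (g := fun i => F i (j + 2 * (n + 1)) - F i j) ?_ ?_ ?_ i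
    · intro i
      simp only [hF1, Pi.neg_apply]
      ring
    · intro i
      simp only [hF2]
    · intro a ha
      have := hF3 ⟨a, ha⟩
      simp only at this
      simp only [this, hG2]
      ring

/-- For an integer x, |x| ≤ 1 means x³ = x, and F³ - F is again odd and periodic, so it suffices
that it vanishes on the grid. -/
theorem IsOddPeriodic.values {m n : ℕ} {F : ℤ → ℤ → ℤ}
    (hF : IsOddPeriodic (2 * (m + 1)) (2 * (n + 1)) F)
    (h : ∀ i j : ℕ, i < m → j < n → |F (i + 1) (j + 1)| ≤ 1) (i j : ℤ) : |F i j| ≤ 1 := by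
  have hcube : F i j ^ 3 - F i j = 0 := by
    refine IsOddPeriodic.eq_zero (m := m) (n := n) (F := fun i j => F i j ^ 3 - F i j)
      ⟨?_, ?_, ?_, ?_⟩ ?_ i j
    · intro i j
      simp only [hF.odd_left]
      ring
    · intro i j
      simp only [hF.odd_right]
      ring
    · intro i j
      simp only [hF.periodic_left]
    · intro i j
      simp only [hF.periodic_right]
    · intro i j hi hj
      have := abs_le.1 (h i j hi hj)
      generalize F (i + 1) (j + 1) = x at this
      obtain ⟨h1, h2⟩ := this
      interval_cases x <;> norm_num
  have hprod : F i j * ((F i j - 1) * (F i j + 1)) = 0 := by linear_combination hcube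
  rcases mul_eq_zero.1 hprod with h0 | h0
  · simp [h0]
  · rcases mul_eq_zero.1 h0 with h0 | h0
    · simp [show F i j = 1 by omega]
    · simp [show F i j = -1 by omega]

theorem IsBDF.exists_extension {m n : ℕ} {f : Fin m × Fin n → ℤ} (hf : IsBDF (gridGraph m n) f) :
    ∃ F : ℤ → ℤ → ℤ, IsOddPeriodic (2 * (m + 1)) (2 * (n + 1)) F ∧ IsBalanced F ∧
      (∀ i j, |F i j| ≤ 1) ∧
      ∀ (i : Fin m) (j : Fin n), F ((i : ℕ) + 1) ((j : ℕ) + 1) = f (i, j) := by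
  obtain ⟨F, hF, hFf⟩ := exists_isOddPeriodic_extension f
  refine ⟨F, hF, ?_, hF.values fun i j hi hj => ?_, hFf⟩
  -- The neighbourhood sum is itself odd and periodic, so it need only vanish on the grid; there the
  -- zero lines around the grid stand in for the missing neighbours.
  · refine IsOddPeriodic.eq_zero (m := m) (n := n)
      (F := fun i j => F i j + F (i + 1) j + F (i - 1) j + F i (j + 1) + F i (j - 1))
      ⟨?_, ?_, ?_, ?_⟩ ?_
    · intro i j
      have h1 := hF.odd_left (i - 1) j
      have h2 := hF.odd_left (i + 1) j
      rw [show -(i - 1) = -i + 1 by ring] at h1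
      rw [show -(i + 1) = -i - 1 by ring] at h2
      simp only [h1, h2, hF.odd_left i]
      ring
    · intro i j
      have h1 := hF.odd_right i (j - 1)
      have h2 := hF.odd_right i (j + 1)
      rw [show -(j - 1) = -j + 1 by ring] at h1
      rw [show -(j + 1) = -j - 1 by ring] at h2
      simp only [h1, h2, fun i => hF.odd_right i j]
      ring
    · intro i j
      have h1 := hF.periodic_left (i - 1) j
      have h2 := hF.periodic_left (i + 1) j
      rw [show i - 1 + 2 * ((m : ℤ) + 1) = i + 2 * (m + 1) - 1 by ring] at h1
      rw [show i + 1 + 2 * ((m : ℤ) + 1) = i + 2 * (m + 1) + 1 by ring] at h2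
      simp only [h1, h2, hF.periodic_left i]
    · intro i j
      have h1 := hF.periodic_right i (j - 1)
      have h2 := hF.periodic_right i (j + 1)
      rw [show j - 1 + 2 * ((n : ℤ) + 1) = j + 2 * (n + 1) - 1 by ring] at h1
      rw [show j + 1 + 2 * ((n : ℤ) + 1) = j + 2 * (n + 1) + 1 by ring] at h2
      simp only [h1, h2, fun i => hF.periodic_right i j]
    · intro i j hi hj
      exact hf.gridGraph_apply hFf hF.apply_zero_left hF.apply_half_left hF.apply_zero_right
        hF.apply_half_right ⟨i, hi⟩ ⟨j, hj⟩
  · have h1 := hFf ⟨i, hi⟩ ⟨j, hj⟩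
    simp only at h1
    rw [h1]
    rcases hf.1 (⟨i, hi⟩, ⟨j, hj⟩) with h | h | h <;> simp [h]

/-! ### Fourier analysis on `ZMod L` -/

open scoped ZMod in
theorem ZMod.dft_comp_add {E : Type*} [AddCommGroup E] [Module ℂ E] {L : ℕ} [NeZero L]
    (Φ : ZMod L → E) (c a : ZMod L) :
    𝓕 (fun i => Φ (i + c)) a = ZMod.stdAddChar (c * a) • 𝓕 Φ a := by
  rw [ZMod.dft_apply, ZMod.dft_apply, Finset.smul_sum]
  refine Fintype.sum_equiv (Equiv.addRight c) _ _ fun i => ?_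
  rw [smul_smul, ← AddChar.map_add_eq_mul]
  congr 2
  simp only [Equiv.coe_addRight]
  ring

/-- The function on `ZMod L × ZMod L` with Fourier coefficients `K`. -/
noncomputable def fourierSynthesis {L : ℕ} [NeZero L] (K : ZMod L → ZMod L → ℂ) (i j : ZMod L) :
    ℂ :=
  (L : ℂ)⁻¹ * (L : ℂ)⁻¹ *
    ∑ a, ∑ b, ZMod.stdAddChar (a * i) * ZMod.stdAddChar (b * j) * K a b

section fourierSynthesis

variable {L : ℕ} [NeZero L] {K : ZMod L → ZMod L → ℂ}

open scoped ZMod in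
theorem fourierSynthesis_dft (Φ : ZMod L → ZMod L → ℂ) (i j : ZMod L) :
    fourierSynthesis (fun a b => 𝓕 (𝓕 Φ a) b) i j = Φ i j := by
  have h1 : Φ i = (L : ℂ)⁻¹ • ∑ a, ZMod.stdAddChar (a * i) • 𝓕 Φ a := by
    rw [← ZMod.invDFT_apply, LinearEquiv.symm_apply_apply]
  have h2 : ∀ a, 𝓕 Φ a j = (L : ℂ)⁻¹ • ∑ b, ZMod.stdAddChar (b * j) • 𝓕 (𝓕 Φ a) b := by
    intro a
    rw [← ZMod.invDFT_apply, LinearEquiv.symm_apply_apply]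
  rw [h1, fourierSynthesis, Pi.smul_apply, Finset.sum_apply, smul_eq_mul, mul_assoc]
  congr 1
  rw [Finset.mul_sum]
  refine Finset.sum_congr rfl fun a _ => ?_
  rw [Pi.smul_apply, h2, smul_eq_mul, smul_eq_mul, Finset.mul_sum, Finset.mul_sum, Finset.mul_sum]
  refine Finset.sum_congr rfl fun b _ => ?_
  rw [smul_eq_mul]
  ring

theorem fourierSynthesis_add (K K' : ZMod L → ZMod L → ℂ) (i j : ZMod L) :
    fourierSynthesis (fun a b => K a b + K' a b) i j =
      fourierSynthesis K i j + fourierSynthesis K' i j := by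
  simp only [fourierSynthesis, mul_add, Finset.sum_add_distrib]

theorem fourierSynthesis_neg_left (hK : ∀ a b, K (-a) b = -K a b) (i j : ZMod L) :
    fourierSynthesis K (-i) j = -fourierSynthesis K i j := by
  rw [fourierSynthesis, fourierSynthesis, ← mul_neg, ← Finset.sum_neg_distrib]
  congr 1
  refine Fintype.sum_equiv (Equiv.neg _) _ _ fun a => ?_
  rw [← Finset.sum_neg_distrib]
  refine Finset.sum_congr rfl fun b _ => ?_
  rw [Equiv.neg_apply, hK, neg_mul_comm, mul_neg (_ * _), neg_neg]

theorem fourierSynthesis_neg_right (hK : ∀ a b, K a (-b) = -K a b) (i j : ZMod L) :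
    fourierSynthesis K i (-j) = -fourierSynthesis K i j := by
  rw [fourierSynthesis, fourierSynthesis, ← mul_neg, ← Finset.sum_neg_distrib]
  congr 1
  refine Finset.sum_congr rfl fun a _ => ?_
  rw [← Finset.sum_neg_distrib]
  refine Fintype.sum_equiv (Equiv.neg _) _ _ fun b => ?_
  rw [Equiv.neg_apply, hK, neg_mul_comm, mul_neg (_ * _), neg_neg]

theorem fourierSynthesis_add_left {p : ZMod L} (hK : ∀ a b, K a b ≠ 0 → a * p = 0)
    (i j : ZMod L) : fourierSynthesis K (i + p) j = fourierSynthesis K i j := by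
  rw [fourierSynthesis, fourierSynthesis]
  congr 1
  refine Finset.sum_congr rfl fun a _ => Finset.sum_congr rfl fun b _ => ?_
  by_cases h : K a b = 0
  · simp [h]
  · rw [mul_add, hK a b h, add_zero]

theorem fourierSynthesis_add_right {q : ZMod L} (hK : ∀ a b, K a b ≠ 0 → b * q = 0)
    (i j : ZMod L) : fourierSynthesis K i (j + q) = fourierSynthesis K i j := by
  rw [fourierSynthesis, fourierSynthesis]
  congr 1
  refine Finset.sum_congr rfl fun a _ => Finset.sum_congr rfl fun b _ => ?_
  by_cases h : K a b = 0
  · simp [h]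
  · rw [mul_add, hK a b h, add_zero]

open Classical in
theorem isOddPeriodic_fourierSynthesis (hK1 : ∀ a b, K (-a) b = -K a b)
    (hK2 : ∀ a b, K a (-b) = -K a b) (p q : ℤ) :
    IsOddPeriodic p q fun i j : ℤ => fourierSynthesis
      (fun a b => if a * (p : ZMod L) = 0 ∧ b * (q : ZMod L) = 0 then K a b else 0) i j := by
  refine ⟨fun i j => ?_, fun i j => ?_, fun i j => ?_, fun i j => ?_⟩
  · rw [Int.cast_neg]
    refine fourierSynthesis_neg_left (fun a b => ?_) _ _
    simp only [neg_mul, neg_eq_zero, hK1]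
    split_ifs <;> simp
  · rw [Int.cast_neg]
    refine fourierSynthesis_neg_right (fun a b => ?_) _ _
    simp only [neg_mul, neg_eq_zero, hK2]
    split_ifs <;> simp
  · rw [Int.cast_add]
    refine fourierSynthesis_add_left (fun a b h => ?_) _ _
    by_contra hcon
    exact h (if_neg fun h' => hcon h'.1)
  · rw [Int.cast_add]
    refine fourierSynthesis_add_right (fun a b h => ?_) _ _
    by_contra hcon
    exact h (if_neg fun h' => hcon h'.2)

end fourierSynthesis

theorem ZMod.stdAddChar_pow_eq_one_iff {L : ℕ} [NeZero L] (a : ZMod L) (k : ℕ) :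
    (ZMod.stdAddChar a : ℂ) ^ k = 1 ↔ a * (k : ZMod L) = 0 := by
  rw [← AddChar.map_nsmul_eq_pow, ← (ZMod.stdAddChar (N := L)).map_zero_eq_one,
    ZMod.injective_stdAddChar.eq_iff, nsmul_eq_mul, mul_comm]

theorem frequency_of_relation {L : ℕ} [NeZero L] {a b : ZMod L} (ha : a ≠ -a) (hb : b ≠ -b)
    (h : (1 : ℂ) + ZMod.stdAddChar a + ZMod.stdAddChar (-a) + ZMod.stdAddChar b +
      ZMod.stdAddChar (-b) = 0) :
    (a * 4 = 0 ∧ b * 3 = 0) ∨ (a * 3 = 0 ∧ b * 4 = 0) ∨ (a * 5 = 0 ∧ b * 5 = 0) := by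
  have hL : ∀ c : ZMod L, (ZMod.stdAddChar c : ℂ) ^ L = 1 := by
    intro c
    rw [ZMod.stdAddChar_pow_eq_one_iff]
    simp
  have h2 : ∀ c : ZMod L, c ≠ -c → (ZMod.stdAddChar c : ℂ) ^ 2 ≠ 1 := by
    intro c hc hc2
    rw [ZMod.stdAddChar_pow_eq_one_iff] at hc2
    exact hc (eq_neg_of_add_eq_zero_left (by push_cast at hc2; rw [← hc2]; ring))
  rw [AddChar.map_neg_eq_inv, AddChar.map_neg_eq_inv] at h
  have := roots_of_unity_of_relation (NeZero.pos L) (hL a) (hL b) (h2 a ha) (h2 b hb) h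
  simpa only [ZMod.stdAddChar_pow_eq_one_iff, Nat.cast_ofNat] using this

-- Translations become multiplication by characters, so balance says that the transform vanishes
-- wherever the five-term sum does not.
open scoped ZMod in
theorem dft_relation {L : ℕ} [NeZero L] {Φ : ZMod L → ZMod L → ℂ}
    (h : ∀ i j, Φ i j + Φ (i + 1) j + Φ (i + -1) j + Φ i (j + 1) + Φ i (j + -1) = 0)
    (a b : ZMod L) :
    ((1 : ℂ) + ZMod.stdAddChar a + ZMod.stdAddChar (-a) + ZMod.stdAddChar b +
      ZMod.stdAddChar (-b)) * 𝓕 (𝓕 Φ a) b = 0 := by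
  have hcomm : ∀ c, 𝓕 (fun i j => Φ i (j + c)) a = fun j => 𝓕 Φ a (j + c) := by
    intro c
    ext j
    simp [ZMod.dft_apply]
  have hsum : Φ + (fun i => Φ (i + 1)) + (fun i => Φ (i + -1)) + (fun i j => Φ i (j + 1)) +
      (fun i j => Φ i (j + -1)) = 0 := by
    ext i j
    exact h i j
  have h1 := congrFun (congrArg (fun Ψ => 𝓕 (𝓕 Ψ a)) hsum) b
  simp only [map_add, Pi.add_apply, hcomm, ZMod.dft_comp_add, map_smul, Pi.smul_apply, map_zero,
    Pi.zero_apply, smul_eq_mul, one_mul, neg_mul] at h1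
  linear_combination h1

open scoped ZMod in
open Classical in
theorem IsBalanced.exists_decomposition {F : ℤ → ℤ → ℤ} (hF : IsBalanced F) {p q : ℕ} (hp : 0 < p)
    (hq : 0 < q) (hFo : IsOddPeriodic p q F) :
    ∃ A B C : ℤ → ℤ → ℂ, IsOddPeriodic 4 3 A ∧ IsOddPeriodic 3 4 B ∧ IsOddPeriodic 5 5 C ∧
      ∀ i j, (F i j : ℂ) = A i j + B i j + C i j := by
  have : NeZero (p * q) := ⟨(Nat.mul_pos hp hq).ne'⟩
  -- A common period of both variables.
  let L := p * q
  obtain ⟨Φ, hΦ⟩ : ∃ Φ : ZMod L → ZMod L → ℂ, ∀ i j : ℤ, Φ i j = F i j := by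
    refine ⟨fun a b => F (a.val : ℤ) (b.val : ℤ), fun i j => ?_⟩
    simp only [ZMod.val_intCast]
    congr 1
    have h1 : ∀ i j, F (i + (L : ℕ)) j = F i j := by
      intro i j
      rw [show ((L : ℕ) : ℤ) = q * p by simp [L, mul_comm]]
      exact apply_add_mul_of_periodic (g := fun i => F i j) (fun i => hFo.periodic_left i j) _ _
    have h2 : ∀ i j, F i (j + (L : ℕ)) = F i j := by
      intro i j
      rw [show ((L : ℕ) : ℤ) = p * q by simp [L]]
      exact apply_add_mul_of_periodic (fun j => hFo.periodic_right i j) _ _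
    rw [apply_emod_of_periodic (h2 _),
      apply_emod_of_periodic (g := fun i => F i j) (fun i => h1 i j)]
  have hsurj := ZMod.intCast_surjective (n := L)
  have hΦ1 : ∀ i j, Φ (-i) j = -Φ i j := by
    intro i j
    obtain ⟨i, rfl⟩ := hsurj i
    obtain ⟨j, rfl⟩ := hsurj j
    rw [← Int.cast_neg, hΦ, hΦ, hFo.odd_left]
    push_cast
    rfl
  have hΦ2 : ∀ i j, Φ i (-j) = -Φ i j := by
    intro i j
    obtain ⟨i, rfl⟩ := hsurj i
    obtain ⟨j, rfl⟩ := hsurj j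
    rw [← Int.cast_neg, hΦ, hΦ, hFo.odd_right]
    push_cast
    rfl
  have hΦ3 : ∀ i j, Φ i j + Φ (i + 1) j + Φ (i + -1) j + Φ i (j + 1) + Φ i (j + -1) = 0 := by
    intro i j
    obtain ⟨i, rfl⟩ := hsurj i
    obtain ⟨j, rfl⟩ := hsurj j
    have := hF i j
    rw [sub_eq_add_neg, sub_eq_add_neg] at this
    have h1 : ((1 : ℤ) : ZMod L) = 1 := Int.cast_one
    have h2 : ((-1 : ℤ) : ZMod L) = -1 := by simp
    rw [← h2, ← h1, ← Int.cast_add, ← Int.cast_add, ← Int.cast_add, ← Int.cast_add, hΦ, hΦ, hΦ, hΦ,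
      hΦ]
    exact_mod_cast this
  let K : ZMod L → ZMod L → ℂ := fun a b => 𝓕 (𝓕 Φ a) b
  have hK1 : ∀ a b, K (-a) b = -K a b := by
    intro a b
    have h1 : (fun i => Φ (-i)) = -Φ := by
      ext i j
      exact hΦ1 i j
    have h2 := congrFun (ZMod.dft_comp_neg Φ) a
    rw [h1, map_neg] at h2
    simp only [K, ← h2, Pi.neg_apply, map_neg]
  have hK2 : ∀ a b, K a (-b) = -K a b := by
    intro a b
    have h1 : (fun j => 𝓕 Φ a (-j)) = -𝓕 Φ a := by
      ext j
      simp [ZMod.dft_apply, hΦ2]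
    have h2 := congrFun (ZMod.dft_comp_neg (𝓕 Φ a)) b
    rw [h1, map_neg] at h2
    simp only [K, ← h2, Pi.neg_apply]
  refine ⟨_, _, _, isOddPeriodic_fourierSynthesis hK1 hK2 4 3,
    isOddPeriodic_fourierSynthesis hK1 hK2 3 4, isOddPeriodic_fourierSynthesis hK1 hK2 5 5,
    fun i j => ?_⟩
  rw [← hΦ, ← fourierSynthesis_dft Φ, ← fourierSynthesis_add, ← fourierSynthesis_add]
  congr 1
  ext a b
  change K a b = _
  push_cast
  by_cases hK : K a b = 0
  · simp [hK]
  · have ha : a ≠ -a := by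
      intro h
      have := hK1 a b
      rw [← h] at this
      exact hK (self_eq_neg.1 this)
    have hb : b ≠ -b := by
      intro h
      have := hK2 a b
      rw [← h] at this
      exact hK (self_eq_neg.1 this)
    have ha0 : a ≠ 0 := by
      rintro rfl
      simp at ha
    -- The three frequency conditions exclude one another, so each nonzero coefficient lies in
    -- exactly one summand.
    have h43 : ¬(a * 4 = 0 ∧ a * 3 = 0) := fun h => ha0 (by linear_combination h.1 - h.2)
    have h45 : ¬(a * 4 = 0 ∧ a * 5 = 0) := fun h => ha0 (by linear_combination h.2 - h.1)
    have h35 : ¬(a * 3 = 0 ∧ a * 5 = 0) := fun h => ha0 (by linear_combination 2 * h.1 - h.2)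
    rcases frequency_of_relation ha hb ((mul_eq_zero.1 (dft_relation hΦ3 a b)).resolve_right hK)
      with h | h | h
    · rw [if_pos h, if_neg (by tauto), if_neg (by tauto)]
      ring
    · rw [if_pos h, if_neg (by tauto), if_neg (by tauto)]
      ring
    · rw [if_pos h, if_neg (by tauto), if_neg (by tauto)]
      ring

/-! ### Only one pair of periods survives -/

theorem IsOddPeriodic.swap {E : Type*} [AddGroup E] {p q : ℤ} {F : ℤ → ℤ → E}
    (hF : IsOddPeriodic p q F) : IsOddPeriodic q p fun i j => F j i :=
  ⟨fun i j => hF.odd_right j i, fun i j => hF.odd_left j i, fun i j => hF.periodic_right j i,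
    fun i j => hF.periodic_left j i⟩

theorem IsOddPeriodic.apply_add_mul {E : Type*} [AddGroup E] {p q : ℤ} {F : ℤ → ℤ → E}
    (hF : IsOddPeriodic p q F) (i j a b : ℤ) : F (i + a * p) (j + b * q) = F i j := by
  rw [apply_add_mul_of_periodic (hF.periodic_right _),
    apply_add_mul_of_periodic (g := fun i => F i j) fun i => hF.periodic_left i j]

theorem IsOddPeriodic.of_intCast {p q : ℤ} {F : ℤ → ℤ → ℤ} {A : ℤ → ℤ → ℂ}
    (hA : IsOddPeriodic p q A) (h : ∀ i j, (F i j : ℂ) = A i j) : IsOddPeriodic p q F := by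
  refine ⟨fun i j => ?_, fun i j => ?_, fun i j => ?_, fun i j => ?_⟩ <;>
    apply Int.cast_injective (α := ℂ)
  · push_cast
    rw [h, h, hA.odd_left]
  · push_cast
    rw [h, h, hA.odd_right]
  · rw [h, h, hA.periodic_left]
  · rw [h, h, hA.periodic_right]

section OneVariable

variable {E : Type*} [AddGroup E] [IsAddTorsionFree E] {g : ℤ → E}

/-- An odd sequence of period `4` is `g 1, 0, -g 1, 0, ...`. -/
theorem apply_of_odd_of_periodic_four (hodd : ∀ i, g (-i) = -g i) (hper : ∀ i, g (i + 4) = g i)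
    (i : ℤ) : g (2 * i) = 0 ∧ g (4 * i + 1) = g 1 ∧ g (4 * i + 3) = -g 1 := by
  have h : ∀ i k, g (i + k * 4) = g i := apply_add_mul_of_periodic hper
  refine ⟨self_eq_neg.1 ?_, ?_, ?_⟩
  · rw [← hodd, ← h (-(2 * i)) i]
    congr 1
    ring
  · rw [← h 1 i]
    congr 1
    ring
  · rw [← hodd, ← h (-1) (i + 1)]
    congr 1
    ring

/-- An odd sequence of period `3` is `g 1, -g 1, 0, ...`. -/
theorem apply_of_odd_of_periodic_three (hodd : ∀ i, g (-i) = -g i) (hper : ∀ i, g (i + 3) = g i)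
    (i : ℤ) : g (3 * i) = 0 ∧ g (3 * i + 1) = g 1 ∧ g (3 * i + 2) = -g 1 := by
  have h : ∀ i k, g (i + k * 3) = g i := apply_add_mul_of_periodic hper
  refine ⟨self_eq_neg.1 ?_, ?_, ?_⟩
  · rw [← hodd, ← h (-(3 * i)) (2 * i)]
    congr 1
    ring
  · rw [← h 1 i]
    congr 1
    ring
  · rw [← hodd, ← h (-1) (i + 1)]
    congr 1
    ring

theorem eq_zero_of_odd_of_periodic_four (hodd : ∀ i, g (-i) = -g i) (hper : ∀ i, g (i + 4) = g i)
    (h1 : g 1 = 0) (i : ℤ) : g i = 0 := by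
  have h := apply_of_odd_of_periodic_four hodd hper
  obtain h0 | h0 | h0 : i = 2 * (i / 2) ∨ i = 4 * (i / 4) + 1 ∨ i = 4 * (i / 4) + 3 := by omega
  · rw [h0, (h _).1]
  · rw [h0, (h _).2.1, h1]
  · rw [h0, (h _).2.2, h1, neg_zero]

theorem eq_zero_of_odd_of_periodic_three (hodd : ∀ i, g (-i) = -g i) (hper : ∀ i, g (i + 3) = g i)
    (h1 : g 1 = 0) (i : ℤ) : g i = 0 := by
  have h := apply_of_odd_of_periodic_three hodd hper
  obtain h0 | h0 | h0 : i = 3 * (i / 3) ∨ i = 3 * (i / 3) + 1 ∨ i = 3 * (i / 3) + 2 := by omega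
  · rw [h0, (h _).1]
  · rw [h0, (h _).2.1, h1]
  · rw [h0, (h _).2.2, h1, neg_zero]

theorem IsOddPeriodic.eq_zero_four_three {F : ℤ → ℤ → E} (hF : IsOddPeriodic 4 3 F)
    (h : F 1 1 = 0) (i j : ℤ) : F i j = 0 :=
  eq_zero_of_odd_of_periodic_three (hF.odd_right i) (hF.periodic_right i)
    (eq_zero_of_odd_of_periodic_four (g := fun i => F i 1) (fun i => hF.odd_left i 1)
      (fun i => hF.periodic_left i 1) h i) j

theorem IsOddPeriodic.apply_two_left {q : ℤ} {F : ℤ → ℤ → E} (hF : IsOddPeriodic 4 q F) (j : ℤ) :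
    F 2 j = 0 :=
  (apply_of_odd_of_periodic_four (g := fun i => F i j) (fun i => hF.odd_left i j)
    (fun i => hF.periodic_left i j) 1).1

end OneVariable

theorem isOddPeriodic_of_eq_add {F : ℤ → ℤ → ℤ} (hF : ∀ i j, |F i j| ≤ 1) {A C : ℤ → ℤ → ℂ}
    (hA : IsOddPeriodic 4 3 A) (hC : IsOddPeriodic 5 5 C)
    (h : ∀ i j, (F i j : ℂ) = A i j + C i j) : IsOddPeriodic 4 3 F ∨ IsOddPeriodic 5 5 F := by
  -- (25, 10) is (1, 1) modulo (4, 3) and (0, 0) modulo 5, so `C` drops out.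
  have hx : (F 25 10 : ℂ) = A 1 1 := by
    have h1 := hA.apply_add_mul 1 1 6 3
    have h2 := hC.apply_add_mul 0 0 5 2
    norm_num at h1 h2
    rw [h, h1, h2, hC.apply_zero_left, add_zero]
  by_cases hx0 : F 25 10 = 0
  · right
    refine hC.of_intCast fun i j => ?_
    rw [h, hA.eq_zero_four_three (by rw [← hx, hx0, Int.cast_zero]), zero_add]
  · left
    refine hA.of_intCast fun i j => ?_
    -- Both points are (i, j) modulo 5, but they are (1, 1) and (1, -1) modulo (4, 3). So `C i j`
    -- plus and minus A 1 1 = ±1 both lie in [-1, 1], which forces `C i j` = 0.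
    have h1 : (F (5 + 16 * i) (10 + 6 * j) : ℂ) = F 25 10 + C i j := by
      have e1 := hA.apply_add_mul 1 1 (1 + 4 * i) (3 + 2 * j)
      have e2 := hC.apply_add_mul i j (3 * i + 1) (j + 2)
      rw [hx, ← e1, ← e2, h]
      ring_nf
    have h2 : (F (5 + 16 * i) (-10 + 6 * j) : ℂ) = -F 25 10 + C i j := by
      have e1 := hA.apply_add_mul 1 (-1) (1 + 4 * i) (2 * j - 3)
      have e2 := hC.apply_add_mul i j (3 * i + 1) (j - 2)
      rw [hx, ← hA.odd_right, ← e1, ← e2, h]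
      ring_nf
    have h3 : F (5 + 16 * i) (10 + 6 * j) - F 25 10 = F (5 + 16 * i) (-10 + 6 * j) + F 25 10 := by
      apply Int.cast_injective (α := ℂ)
      push_cast
      linear_combination h1 - h2
    have b1 := abs_le.1 (hF (5 + 16 * i) (10 + 6 * j))
    have b2 := abs_le.1 (hF (5 + 16 * i) (-10 + 6 * j))
    have h4 : F (5 + 16 * i) (10 + 6 * j) = F 25 10 := by omega
    rw [h4] at h1
    rw [h, left_eq_add.1 h1, add_zero]

theorem IsBalanced.isOddPeriodic {F : ℤ → ℤ → ℤ} (hF : IsBalanced F) (hF1 : ∀ i j, |F i j| ≤ 1)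
    {p q : ℕ} (hp : 0 < p) (hq : 0 < q) (hFo : IsOddPeriodic p q F) :
    IsOddPeriodic 4 3 F ∨ IsOddPeriodic 3 4 F ∨ IsOddPeriodic 5 5 F := by
  obtain ⟨A, B, C, hA, hB, hC, h⟩ := hF.exists_decomposition hp hq hFo
  -- Multiples of 5 remove `C`, and an even coordinate removes whichever of `A`, `B` has period 4
  -- there. With x = A 1 1 and y = B 1 1, the points below give x, y, x + y and x - y; all are
  -- integers in [-1, 1], so x or y is 0.
  have hx : (F 25 10 : ℂ) = A 1 1 := by
    have h1 := hA.apply_add_mul 1 1 6 3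
    have h2 := hB.apply_add_mul 1 2 8 2
    have h3 := hC.apply_add_mul 0 0 5 2
    norm_num at h1 h2 h3
    rw [h, h1, h2, h3, hC.apply_zero_left, hB.swap.apply_two_left, add_zero, add_zero]
  have hy : (F 10 25 : ℂ) = B 1 1 := by
    have h1 := hA.apply_add_mul 2 1 2 8
    have h2 := hB.apply_add_mul 1 1 3 6
    have h3 := hC.apply_add_mul 0 0 2 5
    norm_num at h1 h2 h3
    rw [h, h1, h2, h3, hC.apply_zero_left, hA.apply_two_left, add_zero, zero_add]
  have hxy : F 25 25 = F 25 10 + F 10 25 := by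
    apply Int.cast_injective (α := ℂ)
    have h1 := hA.apply_add_mul 1 1 6 8
    have h2 := hB.apply_add_mul 1 1 8 6
    have h3 := hC.apply_add_mul 0 0 5 5
    norm_num at h1 h2 h3
    push_cast
    rw [hx, hy, h, h1, h2, h3, hC.apply_zero_left, add_zero]
  have hxy' : F 25 7 = F 25 10 - F 10 25 := by
    apply Int.cast_injective (α := ℂ)
    have h1 := hA.apply_add_mul 1 1 6 2
    have h2 := hB.apply_add_mul 1 (-1) 8 2
    have h3 := hC.apply_add_mul 0 7 5 0
    norm_num at h1 h2 h3
    push_cast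
    rw [hx, hy, h, h1, h2, h3, hC.apply_zero_left, add_zero, hB.odd_right, sub_eq_add_neg]
  have b1 := abs_le.1 (hF1 25 25)
  have b2 := abs_le.1 (hF1 25 7)
  obtain h0 | h0 : F 25 10 = 0 ∨ F 10 25 = 0 := by omega
  · have hA0 := hA.eq_zero_four_three (by rw [← hx, h0, Int.cast_zero])
    rcases isOddPeriodic_of_eq_add (F := fun i j => F j i) (fun i j => hF1 j i) hB.swap hC.swap
      (fun i j => by rw [h, hA0, zero_add]) with h1 | h1
    · exact Or.inr (Or.inl h1.swap)
    · exact Or.inr (Or.inr h1.swap)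
  · have hB0 := hB.swap.eq_zero_four_three (by rw [← hy, h0, Int.cast_zero])
    rcases isOddPeriodic_of_eq_add hF1 hA hC (fun i j => by rw [h, hB0 j i, add_zero]) with h1 | h1
    · exact Or.inl h1
    · exact Or.inr (Or.inr h1)

/-! ### Periods 3 and 4: Types 1 and 2 -/

/-- The sequence `1, 0, -1, 0, 1, 0, -1, 0, ...`. -/
def signFour (i : ℕ) : ℤ := if i % 2 = 0 then (-1) ^ (i / 2) else 0

/-- The sequence `1, -1, 0, 1, -1, 0, ...`. -/
def signThree (i : ℕ) : ℤ := if i % 3 = 0 then 1 else if i % 3 = 1 then -1 else 0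

theorem eq_signFour_mul {g : ℤ → ℤ} (hodd : ∀ i, g (-i) = -g i) (hper : ∀ i, g (i + 4) = g i)
    (i : ℕ) : g (i + 1) = signFour i * g 1 := by
  have h := apply_of_odd_of_periodic_four hodd hper
  rcases Nat.even_or_odd' i with ⟨k, rfl | rfl⟩
  · rcases Nat.even_or_odd' k with ⟨l, rfl | rfl⟩
    · rw [signFour, if_pos (by omega), show 2 * (2 * l) / 2 = 2 * l by omega, pow_mul]
      have := (h l).2.1
      push_cast
      rw [show (2 * (2 * l) + 1 : ℤ) = 4 * l + 1 by ring, this]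
      simp
    · rw [signFour, if_pos (by omega), show 2 * (2 * l + 1) / 2 = 2 * l + 1 by omega, pow_succ,
        pow_mul]
      have := (h l).2.2
      push_cast
      rw [show (2 * (2 * l + 1) + 1 : ℤ) = 4 * l + 3 by ring, this]
      simp
  · rw [signFour, if_neg (by omega), zero_mul]
    have := (h (k + 1)).1
    push_cast
    rw [← this]
    congr 1

theorem eq_signThree_mul {g : ℤ → ℤ} (hodd : ∀ i, g (-i) = -g i) (hper : ∀ i, g (i + 3) = g i)
    (i : ℕ) : g (i + 1) = signThree i * g 1 := by
  have h := apply_of_odd_of_periodic_three hodd hper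
  obtain h0 | h0 | h0 : i % 3 = 0 ∨ i % 3 = 1 ∨ i % 3 = 2 := by omega
  · rw [show (i + 1 : ℤ) = 3 * (i / 3 : ℕ) + 1 by omega, (h _).2.1]
    simp [signThree, h0]
  · rw [show (i + 1 : ℤ) = 3 * (i / 3 : ℕ) + 2 by omega, (h _).2.2]
    simp [signThree, h0]
  · rw [show (i + 1 : ℤ) = 3 * ((i / 3 : ℕ) + 1) by omega, (h _).1]
    simp [signThree, h0]

theorem signFour_eq_zero {i : ℕ} (h : signFour i = 0) : i % 2 = 1 := by
  by_contra hi
  rw [signFour, if_pos (by omega)] at h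
  exact absurd h (by simp)

theorem signThree_eq_zero {i : ℕ} (h : signThree i = 0) : i % 3 = 2 := by
  unfold signThree at h
  split_ifs at h <;> omega

theorem IsOddPeriodic.eq_sign_mul {F : ℤ → ℤ → ℤ} (hF : IsOddPeriodic 4 3 F) (i j : ℕ) :
    F (i + 1) (j + 1) = signFour i * signThree j * F 1 1 := by
  rw [eq_signThree_mul (hF.odd_right _) (hF.periodic_right _),
    eq_signFour_mul (g := fun i => F i 1) (fun i => hF.odd_left i 1) fun i => hF.periodic_left i 1]
  ring

theorem blockOne_apply {n : ℕ} (i : Fin 1) (j : Fin n) : blockOne n i j = signThree j := by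
  obtain rfl := Subsingleton.elim i 0
  simp only [blockOne, sideBySide, signThree]
  obtain h | h | h : (j : ℕ) % 3 = 0 ∨ (j : ℕ) % 3 = 1 ∨ (j : ℕ) % 3 = 2 := by omega
  all_goals simp [h]

theorem blockTwo_apply {n : ℕ} (i : Fin 2) (j : Fin n) :
    blockTwo n i j = signThree i * signFour j := by
  simp only [blockTwo, sideBySide, signThree, signFour]
  obtain h | h : (j : ℕ) % 2 = 0 ∨ (j : ℕ) % 2 = 1 := by omega
  all_goals fin_cases i <;> simp [h]

theorem stacked_blockOne_apply {m n : ℕ} (c : ℕ) (i : Fin m) (j : Fin n) :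
    stacked m (fun q => (-1 : ℤ) ^ (q + c) • blockOne n) i j =
      (-1) ^ c * (signFour i * signThree j) := by
  obtain h | h : (i : ℕ) % 2 = 0 ∨ (i : ℕ) % 2 = 1 := by omega
  · simp [stacked, blockOne_apply, signFour, h, pow_add]
    ring
  · simp [stacked, signFour, h]

theorem stacked_blockTwo_apply {m n : ℕ} (i : Fin m) (j : Fin n) :
    stacked m (fun _ => blockTwo n) i j = signThree i * signFour j := by
  obtain h | h | h : (i : ℕ) % 3 = 0 ∨ (i : ℕ) % 3 = 1 ∨ (i : ℕ) % 3 = 2 := by omega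
  all_goals simp [stacked, blockTwo_apply, signThree, h]

theorem stacked_neg {h m n : ℕ} (B : ℕ → Matrix (Fin h) (Fin n) ℤ) (i : Fin m) (j : Fin n) :
    stacked m (fun q => -B q) i j = -stacked m B i j := by
  simp only [stacked]
  split_ifs <;> simp

/-- `F` is a product of two sign sequences up to the sign F 1 1; the zero lines m + 1 and n + 1 must
fall on zeros of these sequences, whence the congruences. -/
theorem IsOddPeriodic.isTypeOne {m n : ℕ} {f : Fin m × Fin n → ℤ} {F : ℤ → ℤ → ℤ}
    (hF : IsOddPeriodic 4 3 F) (hx : F 1 1 = 1 ∨ F 1 1 = -1)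
    (hFf : ∀ (i : Fin m) (j : Fin n), F ((i : ℕ) + 1) ((j : ℕ) + 1) = f (i, j))
    (hm : ∀ j, F (m + 1) j = 0) (hn : ∀ i, F i (n + 1) = 0) : IsTypeOne f := by
  have hx0 : F 1 1 ≠ 0 := by omega
  refine ⟨signFour_eq_zero ?_, signThree_eq_zero ?_, ?_⟩
  · have := hF.eq_sign_mul m 0
    rw [hm, zero_eq_mul] at this
    simpa [signThree, hx0] using this
  · have := hF.eq_sign_mul 0 n
    rw [hn, zero_eq_mul] at this
    simpa [signFour, hx0] using this
  · refine hx.imp (fun hx i j => ?_) (fun hx i j => ?_)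
    · rw [← hFf, hF.eq_sign_mul, hx]
      simpa using (stacked_blockOne_apply 0 i j).symm
    · rw [← hFf, hF.eq_sign_mul, hx, stacked_blockOne_apply]
      ring

theorem IsOddPeriodic.isTypeTwo {m n : ℕ} {f : Fin m × Fin n → ℤ} {F : ℤ → ℤ → ℤ}
    (hF : IsOddPeriodic 3 4 F) (hx : F 1 1 = 1 ∨ F 1 1 = -1)
    (hFf : ∀ (i : Fin m) (j : Fin n), F ((i : ℕ) + 1) ((j : ℕ) + 1) = f (i, j))
    (hm : ∀ j, F (m + 1) j = 0) (hn : ∀ i, F i (n + 1) = 0) : IsTypeTwo f := by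
  have hx0 : F 1 1 ≠ 0 := by omega
  have h : ∀ i j : ℕ, F (i + 1) (j + 1) = signFour j * signThree i * F 1 1 :=
    fun i j => hF.swap.eq_sign_mul j i
  refine ⟨signThree_eq_zero ?_, signFour_eq_zero ?_, ?_⟩
  · have := h m 0
    rw [hm, zero_eq_mul] at this
    simpa [signFour, hx0] using this
  · have := h 0 n
    rw [hn, zero_eq_mul] at this
    simpa [signThree, hx0] using this
  · refine hx.imp (fun hx i j => ?_) (fun hx i j => ?_)
    · rw [← hFf, h, hx, stacked_blockTwo_apply]
      ring
    · rw [← hFf, h, hx, stacked_neg, stacked_blockTwo_apply]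
      ring

/-! ### Period 5: Type 3 -/

theorem IsOddPeriodic.apply_five_left {F : ℤ → ℤ → ℤ} (hF : IsOddPeriodic 5 5 F) (i j : ℤ) :
    F (5 - i) j = -F i j := by
  rw [← hF.odd_left, ← hF.periodic_left (-i)]
  congr 1
  ring

theorem IsOddPeriodic.apply_five_right {F : ℤ → ℤ → ℤ} (hF : IsOddPeriodic 5 5 F) (i j : ℤ) :
    F i (5 - j) = -F i j :=
  hF.swap.apply_five_left j i

theorem IsOddPeriodic.apply_emod_five {F : ℤ → ℤ → ℤ} (hF : IsOddPeriodic 5 5 F) (i j : ℤ) :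
    F (i % 5) (j % 5) = F i j := by
  rw [apply_emod_of_periodic (hF.periodic_right _),
    apply_emod_of_periodic (g := fun i => F i j) fun i => hF.periodic_left i j]

/-- Balance at (1, 1) and at (1, 2), where F 1 3 = -F 1 2. Together with the symmetries this leaves
only F 1 1 and F 1 2 free. -/
theorem IsOddPeriodic.relations_five {F : ℤ → ℤ → ℤ} (hF : IsOddPeriodic 5 5 F)
    (hFb : IsBalanced F) : F 1 1 + F 2 1 + F 1 2 = 0 ∧ F 2 2 = -F 1 1 := by
  have e11 := hFb 1 1
  have e12 := hFb 1 2
  norm_num [hF.apply_zero_left, hF.apply_zero_right] at e11 e12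
  have h13 := hF.apply_five_right 1 2
  norm_num at h13
  omega

theorem IsOddPeriodic.eq_matrix_five {F : ℤ → ℤ → ℤ} (hF : IsOddPeriodic 5 5 F)
    (hFb : IsBalanced F) {p q r : ℤ} (hp : F 1 1 = p) (hq : F 1 2 = q) (hr : F 2 1 = r)
    (a b : Fin 4) : F ((a : ℕ) + 1) ((b : ℕ) + 1) =
      !![p, q, -q, -p; r, -p, p, -r; -r, p, -p, r; -p, -q, q, p] a b := by
  have h22 := (hF.relations_five hFb).2
  have hright : ∀ i, F i 3 = -F i 2 ∧ F i 4 = -F i 1 :=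
    fun i => ⟨hF.apply_five_right i 2, hF.apply_five_right i 1⟩
  have hleft : ∀ j, F 3 j = -F 2 j ∧ F 4 j = -F 1 j :=
    fun j => ⟨hF.apply_five_left 2 j, hF.apply_five_left 1 j⟩
  fin_cases a <;> fin_cases b <;>
    simp [(hright _).1, (hright _).2, (hleft _).1, (hleft _).2, h22, hp, hq, hr]

/-- The nonzero triples in {-1, 0, 1} with sum zero are six, in three opposite pairs: one pair for
each pattern. -/
theorem exists_pattern {F : ℤ → ℤ → ℤ} (hF : IsOddPeriodic 5 5 F) (hFb : IsBalanced F)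
    (hF1 : ∀ i j, |F i j| ≤ 1) (h0 : F 1 1 ≠ 0 ∨ F 1 2 ≠ 0) :
    ∃ t : Fin 3, (∀ a b : Fin 4, F ((a : ℕ) + 1) ((b : ℕ) + 1) = pattern t a b) ∨
      ∀ a b : Fin 4, F ((a : ℕ) + 1) ((b : ℕ) + 1) = (-pattern t) a b := by
  have e := (hF.relations_five hFb).1
  have b1 := abs_le.1 (hF1 1 1)
  have b2 := abs_le.1 (hF1 1 2)
  have b3 := abs_le.1 (hF1 2 1)
  obtain ⟨h1, h2, h3⟩ | ⟨h1, h2, h3⟩ | ⟨h1, h2, h3⟩ | ⟨h1, h2, h3⟩ | ⟨h1, h2, h3⟩ |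
    ⟨h1, h2, h3⟩ : (F 1 1 = 0 ∧ F 1 2 = 1 ∧ F 2 1 = -1) ∨ (F 1 1 = 0 ∧ F 1 2 = -1 ∧ F 2 1 = 1) ∨
      (F 1 1 = 1 ∧ F 1 2 = -1 ∧ F 2 1 = 0) ∨ (F 1 1 = -1 ∧ F 1 2 = 1 ∧ F 2 1 = 0) ∨
      (F 1 1 = 1 ∧ F 1 2 = 0 ∧ F 2 1 = -1) ∨ (F 1 1 = -1 ∧ F 1 2 = 0 ∧ F 2 1 = 1) := by omega
  on_goal 1 => refine ⟨0, Or.inl fun a b => ?_⟩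
  on_goal 2 => refine ⟨0, Or.inr fun a b => ?_⟩
  on_goal 3 => refine ⟨1, Or.inl fun a b => ?_⟩
  on_goal 4 => refine ⟨1, Or.inr fun a b => ?_⟩
  on_goal 5 => refine ⟨2, Or.inl fun a b => ?_⟩
  on_goal 6 => refine ⟨2, Or.inr fun a b => ?_⟩
  all_goals
    rw [hF.eq_matrix_five hFb h1 h2 h3]
    fin_cases a <;> fin_cases b <;> rfl

theorem stacked_blockFour_apply {m n : ℕ} {F : ℤ → ℤ → ℤ} (hF : IsOddPeriodic 5 5 F)
    {P : Matrix (Fin 4) (Fin 4) ℤ}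
    (hP : ∀ a b : Fin 4, F ((a : ℕ) + 1) ((b : ℕ) + 1) = P a b) (i : Fin m) (j : Fin n) :
    F ((i : ℕ) + 1) ((j : ℕ) + 1) = stacked m (fun _ => sideBySide n fun _ => P) i j := by
  rw [← hF.apply_emod_five]
  simp only [stacked, sideBySide]
  split_ifs with h1 h2
  · rw [← hP]
    congr 1 <;> dsimp only <;> omega
  · rw [show (((j : ℕ) : ℤ) + 1) % 5 = 0 by omega, hF.apply_zero_right]
  · rw [show (((i : ℕ) : ℤ) + 1) % 5 = 0 by omega, hF.apply_zero_left]

theorem sideBySide_neg {h w n : ℕ} (P : ℕ → Matrix (Fin h) (Fin w) ℤ) :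
    sideBySide n (fun q => -P q) = -sideBySide n P := by
  ext i j
  simp only [sideBySide, Matrix.neg_apply]
  split_ifs <;> simp

/-- Rows 3 and 4 are the negatives of rows 2 and 1, so none of the rows 1, ..., 4 vanishes. -/
theorem IsOddPeriodic.emod_five_eq_zero {F : ℤ → ℤ → ℤ} (hF : IsOddPeriodic 5 5 F)
    (h1 : F 1 1 ≠ 0 ∨ F 1 2 ≠ 0) (h2 : F 2 1 ≠ 0 ∨ F 2 2 ≠ 0) {k : ℤ} (hk : ∀ j, F k j = 0) :
    k % 5 = 0 := by
  have hleft : ∀ j, F 3 j = -F 2 j ∧ F 4 j = -F 1 j :=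
    fun j => ⟨hF.apply_five_left 2 j, hF.apply_five_left 1 j⟩
  have hr1 := hF.apply_emod_five k 1
  have hr2 := hF.apply_emod_five k 2
  rw [hk] at hr1 hr2
  norm_num at hr1 hr2
  have hl1 := hleft 1
  have hl2 := hleft 2
  obtain h | h | h | h | h :
    k % 5 = 0 ∨ k % 5 = 1 ∨ k % 5 = 2 ∨ k % 5 = 3 ∨ k % 5 = 4 := by omega
  all_goals
    rw [h] at hr1 hr2
    omega

theorem IsOddPeriodic.isTypeThree {m n : ℕ} {f : Fin m × Fin n → ℤ} {F : ℤ → ℤ → ℤ}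
    (hF : IsOddPeriodic 5 5 F) (hFb : IsBalanced F) (hF1 : ∀ i j, |F i j| ≤ 1)
    (h0 : F 1 1 ≠ 0 ∨ F 1 2 ≠ 0)
    (hFf : ∀ (i : Fin m) (j : Fin n), F ((i : ℕ) + 1) ((j : ℕ) + 1) = f (i, j))
    (hm : ∀ j, F (m + 1) j = 0) (hn : ∀ i, F i (n + 1) = 0) : IsTypeThree f := by
  obtain ⟨e1, e2⟩ := hF.relations_five hFb
  have hm5 := hF.emod_five_eq_zero h0 (by omega) hm
  have hn5 := hF.swap.emod_five_eq_zero (by omega) (by omega) hn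
  refine ⟨?_, ?_, ?_⟩
  · simp only [Nat.ModEq]
    omega
  · simp only [Nat.ModEq]
    omega
  · obtain ⟨t, ht⟩ := exists_pattern hF hFb hF1 h0
    refine ⟨t, ht.imp (fun ht i j => ?_) (fun ht i j => ?_)⟩
    · rw [← hFf]
      exact stacked_blockFour_apply hF ht i j
    · rw [← hFf, stacked_blockFour_apply hF ht i j, blockFour, ← sideBySide_neg]

/-! ### The classification -/

theorem mainTheorem7 (m n : ℕ) (hmn : m ≤ n) (f : Fin m × Fin n → ℤ)
    (hf : IsBDF (gridGraph m n) f) (hf0 : f ≠ 0) :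
    IsTypeOne f ∨ IsTypeTwo f ∨ IsTypeThree f := by
  obtain ⟨F, hF, hFb, hF1, hFf⟩ := hf.exists_extension
  have hm := hF.apply_half_left
  have hn := hF.apply_half_right
  have hne : ∃ i j, F i j ≠ 0 := by
    by_contra! h
    refine hf0 (funext fun ⟨i, j⟩ => ?_)
    rw [← hFf, h, Pi.zero_apply]
  have hpm : F 1 1 ≠ 0 → F 1 1 = 1 ∨ F 1 1 = -1 := by
    intro h
    have := abs_le.1 (hF1 1 1)
    omega
  rcases hFb.isOddPeriodic hF1 (p := 2 * (m + 1)) (q := 2 * (n + 1)) (by omega) (by omega)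
    (by exact_mod_cast hF) with h | h | h
  · left
    refine h.isTypeOne (hpm fun h1 => ?_) hFf hm hn
    obtain ⟨i, j, hij⟩ := hne
    exact hij (h.eq_zero_four_three h1 i j)
  · right; left
    refine h.isTypeTwo (hpm fun h1 => ?_) hFf hm hn
    obtain ⟨i, j, hij⟩ := hne
    exact hij (h.swap.eq_zero_four_three h1 j i)
  · right; right
    refine h.isTypeThree hFb hF1 ?_ hFf hm hn
    -- If F 1 1 = F 1 2 = 0, then F 2 1 = 0 too, the whole 4 × 4 pattern is zero, and so is `f`.
    by_contra! h1
    obtain ⟨e1, e2⟩ := h.relations_five hFb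
    refine hf0 (funext fun ⟨i, j⟩ => ?_)
    rw [← hFf, stacked_blockFour_apply h (h.eq_matrix_five hFb h1.1 h1.2 (r := 0) (by omega))]
    simp only [stacked, sideBySide]
    split_ifs with h1 h2
    · generalize (⟨(i : ℕ) % (4 + 1), h1⟩ : Fin 4) = a
      generalize (⟨(j : ℕ) % (4 + 1), h2⟩ : Fin 4) = b
      fin_cases a <;> fin_cases b <;> rfl
    · rfl
    · rfl
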